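/- Let $n,m,k$ be natural numbers with $k\ge n$ and $k\ge m$, and let $\bar Y\in\mathbb{R}^{n\times m}$, $P\in\mathbb{R}^{n\times k}$, $Q\in\mathbb{R}^{m\times k}$ be arbitrary. By a singular value decomposition (SVD) of a real $a\times b$ matrix $A$ we mean a factorization $A=USV^\top$ with $U\in\mathbb{R}^{a\times a}$ and $V\in\mathbb{R}^{b\times b}$ orthogonal and $S\in\mathbb{R}^{a\times b}$ rectangular diagonal with nonnegative diagonal entries, in any order. Consider the gradient flow $$\frac{d}{dt}\begin{bmatrix}P\\Q\end{bmatrix}=f_Z\left(\begin{bmatrix}P\\Q\end{bmatrix}\right):=\begin{bmatrix}(\bar Y-PQ^\top)Q\\(\bar Y-PQ^\top)^\top P\end{bmatrix}.$$ Then the following are equivalent. 1. $[P;Q]$ is an equilibrium point of $f_Z$, that is, $(\bar Y-PQ^\top)Q=0$ and $(\bar Y-PQ^\top)^\top P=0$. 2. There exist orthogonal matrices $\Psi\in\mathbb{R}^{n\times n}$, $\Phi\in\mathbb{R}^{m\times m}$, $\Gamma_P,\Gamma_Q\in\mathbb{R}^{k\times k}$ and rectangular diagonal matrices $\Sigma\in\mathbb{R}^{n\times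 m}$, $\Sigma_P\in\mathbb{R}^{n\times k}$, $\Sigma_Q\in\mathbb{R}^{m\times k}$ with nonnegative diagonal entries such that $$\bar Y-PQ^\top=\Psi\Sigma\Phi^\top,\qquad P=\Psi\Sigma_P\Gamma_P^\top,\qquad Q=\Phi\Sigma_Q\Gamma_Q^\top$$ (so these are SVDs of $\bar Y-PQ^\top$, $P$ and $Q$), and $\Sigma\Sigma_Q=0$ and $\Sigma^\top\Sigma_P=0$. -/

import Mathlib

/-- The vector field `f_Z` of the undisturbed gradient flow for the loss `½‖Y - P Qᵀ‖_F²`, on the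
state space of stacked matrices `Z = [P; Q]` with `P` of size `n × k` and `Q` of size `m × k`. -/
def gradFlowField {n m k : ℕ} (Y : Matrix (Fin n) (Fin m) ℝ)
    (Z : Matrix (Fin n ⊕ Fin m) (Fin k) ℝ) : Matrix (Fin n ⊕ Fin m) (Fin k) ℝ :=
  let P : Matrix (Fin n) (Fin k) ℝ := Z.toRows₁
  let Q : Matrix (Fin m) (Fin k) ℝ := Z.toRows₂
  Matrix.fromRows ((Y - P * Q.transpose) * Q) ((Y - P * Q.transpose).transpose * P)

/-- `z` is an equilibrium point of the autonomous system `ż = f z`. -/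
def IsEquilibriumPoint {E : Type*} [Zero E] (f : E → E) (z : E) : Prop :=
  f z = 0

/-- `S` is a rectangular diagonal matrix with nonnegative diagonal entries (in any order). -/
def IsNonnegRectDiagonal {a b : ℕ} (S : Matrix (Fin a) (Fin b) ℝ) : Prop :=
  (∀ (i : Fin a) (j : Fin b), (i : ℕ) ≠ (j : ℕ) → S i j = 0) ∧
  (∀ (i : Fin a) (j : Fin b), (i : ℕ) = (j : ℕ) → 0 ≤ S i j)

/-- `A = U S Vᵀ` is a (full) singular value decomposition of the real `a × b` matrix `A`: `U` and
`V` are square orthogonal matrices and `S` is rectangular diagonal with nonnegative diagonal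
entries. The order of the singular values on the diagonal of `S` is not prescribed. -/
structure IsSVD {a b : ℕ} (A : Matrix (Fin a) (Fin b) ℝ) (U : Matrix (Fin a) (Fin a) ℝ)
    (S : Matrix (Fin a) (Fin b) ℝ) (V : Matrix (Fin b) (Fin b) ℝ) : Prop where
  left_orthogonal : U ∈ Matrix.orthogonalGroup (Fin a) ℝ
  right_orthogonal : V ∈ Matrix.orthogonalGroup (Fin b) ℝ
  diagonal : IsNonnegRectDiagonal S
  eq_mul : A = U * S * V.transpose

/-! Let E = Y - PQᵀ. At an equilibrium EᵀP = 0 and EQ = 0, so the left singular vectors u_i of E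
with positive singular value lie in ker Pᵀ, and the right ones v_i in ker Qᵀ. The symmetric operator
PPᵀ kills the u_i, hence has an orthonormal eigenbasis extending them; its other members are
orthogonal to the range of E, so it still serves as Ψ for E. QQᵀ and the v_i give Φ in the same way
(`LinearMap.exists_svd_of_comp_eq_zero`). For an eigenbasis e of PPᵀ the vectors Pᵀe_i are pairwise
orthogonal in ℝᵏ; since n ≤ k, normalizing and extending them gives Γ_P
(`LinearMap.exists_svd_of_eigenbasis`), and likewise Γ_Q. The shared orthogonal factors then cancel
in EQ and EᵀP, which settles the equations on the diagonal factors and the converse. -/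

open Module

/-! ### Singular value decompositions of operators -/

section LinearMap

/-- If `T` maps a family `e` to pairwise orthogonal vectors, then the normalized nonzero
images extend to an orthonormal basis of a codomain of large enough dimension. -/
theorem LinearMap.exists_orthonormalBasis_apply_eq_smul {V W : Type*}
    [NormedAddCommGroup V] [InnerProductSpace ℝ V] [NormedAddCommGroup W] [InnerProductSpace ℝ W]
    [FiniteDimensional ℝ W] {a b : ℕ} (hab : a ≤ b)
    (hb : finrank ℝ W = b) (T : V →ₗ[ℝ] W) (e : Fin a → V)
    (he : ∀ i j, i ≠ j → inner ℝ (T (e i)) (T (e j)) = 0) :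
    ∃ (c : OrthonormalBasis (Fin b) ℝ W) (σ : Fin a → ℝ), (∀ i, 0 ≤ σ i) ∧
      ∀ i, T (e i) = σ i • c (Fin.castLE hab i) := by
  let g : Fin b → W := fun j =>
    if h : (j : ℕ) < a then (‖T (e ⟨j, h⟩)‖)⁻¹ • T (e ⟨j, h⟩) else 0
  let s : Set (Fin b) := {j | ∃ h : (j : ℕ) < a, T (e ⟨j, h⟩) ≠ 0}
  have hg : Orthonormal ℝ (s.domRestrict g) := by
    constructor
    · rintro ⟨j, h, hj⟩
      have : g j = (‖T (e ⟨j, h⟩)‖)⁻¹ • T (e ⟨j, h⟩) := dif_pos h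
      simp only [Set.domRestrict_apply, this, norm_smul, norm_inv, norm_norm]
      exact inv_mul_cancel₀ (norm_ne_zero_iff.2 hj)
    · rintro ⟨i, hi, _⟩ ⟨j, hj, _⟩ hij
      have h1 : g i = (‖T (e ⟨i, hi⟩)‖)⁻¹ • T (e ⟨i, hi⟩) := dif_pos hi
      have h2 : g j = (‖T (e ⟨j, hj⟩)‖)⁻¹ • T (e ⟨j, hj⟩) := dif_pos hj
      have hne : (⟨i, hi⟩ : Fin a) ≠ ⟨j, hj⟩ := by
        intro h
        exact hij (Subtype.ext (Fin.ext (Fin.mk.inj h)))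
      simp only [Set.domRestrict_apply, h1, h2, real_inner_smul_left, real_inner_smul_right,
        he _ _ hne, mul_zero]
  obtain ⟨c, hc⟩ := Orthonormal.exists_orthonormalBasis_extension_of_card_eq
    (by rw [hb, Fintype.card_fin]) hg
  refine ⟨c, fun i => ‖T (e i)‖, fun i => norm_nonneg _, fun i => ?_⟩
  -- If the image vanishes then σ i = 0, so the unprescribed vector `c i` does not matter.
  by_cases hi : T (e i) = 0
  · simp [hi]
  · have hgi : g (Fin.castLE hab i) = (‖T (e i)‖)⁻¹ • T (e i) := dif_pos i.2
    rw [hc _ ⟨i.2, hi⟩, hgi, smul_inv_smul₀ (norm_ne_zero_iff.2 hi)]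

variable {V W : Type*} [NormedAddCommGroup V] [InnerProductSpace ℝ V] [FiniteDimensional ℝ V]
  [NormedAddCommGroup W] [InnerProductSpace ℝ W] [FiniteDimensional ℝ W]

/-- An orthonormal family in the kernel of a symmetric operator extends to an orthonormal
eigenbasis. -/
theorem LinearMap.IsSymmetric.exists_orthonormalBasis_extension {T : V →ₗ[ℝ] V}
    (hT : T.IsSymmetric) {m r : ℕ} (hm : finrank ℝ V = m) {v : Fin r → V}
    (hv : Orthonormal ℝ v) (hTv : ∀ i, T (v i) = 0) :
    ∃ b : OrthonormalBasis (Fin m) ℝ V,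
      (∀ (i : Fin r) (j : Fin m), (j : ℕ) = i → b j = v i) ∧ ∀ j, ∃ μ : ℝ, T (b j) = μ • b j := by
  set K := Submodule.span ℝ (Set.range v)
  have hrank : r + finrank ℝ Kᗮ = m := by
    rw [← hm, ← K.finrank_add_finrank_orthogonal, finrank_span_eq_card hv.linearIndependent,
      Fintype.card_fin]
  have hmem : ∀ x, x ∈ Kᗮ ↔ ∀ i, inner ℝ (v i) x = 0 := by
    intro x
    constructor
    · intro hx i
      exact (Submodule.mem_orthogonal K x).1 hx _ (Submodule.subset_span ⟨i, rfl⟩)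
    · intro hx
      rw [Submodule.mem_orthogonal]
      intro u hu
      induction hu using Submodule.span_induction with
      | mem u hu => obtain ⟨i, rfl⟩ := hu; exact hx i
      | zero => simp
      | add u w _ _ hu hw => rw [inner_add_left, hu, hw, add_zero]
      | smul c u _ hu => rw [inner_smul_left, hu, mul_zero]
  -- By symmetry the whole range of `T` is orthogonal to its kernel, which contains every `v i`.
  have hinv : ∀ x ∈ Kᗮ, T x ∈ Kᗮ := by
    intro x _
    rw [hmem]
    intro i
    rw [← hT, hTv, inner_zero_left]
  have hS := hT.restrict_invariant hinv
  subst hm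
  set w := hS.eigenvectorBasis rfl
  have hwv : ∀ i j, inner ℝ (v i) (w j : V) = 0 := fun i j => (hmem _).1 (w j).2 i
  have hTw : ∀ j, ∃ μ : ℝ, T (w j : V) = μ • (w j : V) := fun j =>
    ⟨_, congrArg Subtype.val (hS.apply_eigenvectorBasis rfl j)⟩
  have hww := orthonormal_iff_ite.1 w.orthonormal
  have hvv := orthonormal_iff_ite.1 hv
  have hf : Orthonormal ℝ (Fin.append v fun j => (w j : V)) := by
    rw [orthonormal_iff_ite]
    intro i j
    induction i using Fin.addCases with
    | left i =>
      induction j using Fin.addCases with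
      | left j => simp [hvv]
      | right j =>
        have : Fin.castAdd (finrank ℝ Kᗮ) i ≠ Fin.natAdd r j := by
          intro h; have := congrArg Fin.val h; simp at this; omega
        simp [hwv, this]
    | right i =>
      induction j using Fin.addCases with
      | left j =>
        have : Fin.natAdd r i ≠ Fin.castAdd (finrank ℝ Kᗮ) j := by
          intro h; have := congrArg Fin.val h; simp at this; omega
        simp only [Fin.append_left, Fin.append_right, if_neg this]
        rw [real_inner_comm, hwv]
      | right j => simpa using hww i j
  -- The family already has as many vectors as the dimension, so nothing is added: it becomes a
  -- basis.
  obtain ⟨b, hb⟩ := Orthonormal.exists_orthonormalBasis_extension_of_card_eq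
    (ι := Fin (r + finrank ℝ Kᗮ)) (s := Set.univ) (by rw [hrank, Fintype.card_fin])
    (hf.comp _ Subtype.val_injective)
  refine ⟨b.reindex (finCongr hrank), ?_, ?_⟩
  · intro i j hij
    have : (finCongr hrank).symm j = Fin.castAdd _ i := Fin.ext (by simpa using hij)
    rw [OrthonormalBasis.reindex_apply, this, hb _ trivial, Fin.append_left]
  · intro j
    rw [OrthonormalBasis.reindex_apply, hb _ trivial]
    induction (finCongr hrank).symm j using Fin.addCases with
    | left i => exact ⟨0, by simp [hTv]⟩
    | right i => simpa using hTw i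

/-- Compact singular value decomposition. -/
theorem LinearMap.exists_compact_svd (T : V →ₗ[ℝ] W) :
    ∃ (r : ℕ) (v : Fin r → V) (u : Fin r → W) (σ : Fin r → ℝ),
      Orthonormal ℝ v ∧ Orthonormal ℝ u ∧ (∀ i, 0 < σ i) ∧ (∀ i, T (v i) = σ i • u i) ∧
      (∀ i, T.adjoint (u i) = σ i • v i) ∧ ∀ x, (∀ i, inner ℝ (v i) x = 0) → T x = 0 := by
  have hS := T.isPositive_adjoint_comp_self.isSymmetric
  set e := hS.eigenvectorBasis rfl
  set l := hS.eigenvalues rfl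
  have hTe : ∀ i, T.adjoint (T (e i)) = l i • e i := hS.apply_eigenvectorBasis rfl
  have hee := orthonormal_iff_ite.1 e.orthonormal
  have hin : ∀ i j, inner ℝ (T (e i)) (T (e j)) = if i = j then l i else 0 := by
    intro i j
    rw [← LinearMap.adjoint_inner_left, hTe, real_inner_smul_left, hee]
    simp
  have hnn : ∀ i, 0 ≤ l i := by
    intro i
    have := hin i i
    rw [if_pos rfl] at this
    exact this ▸ real_inner_self_nonneg
  -- Enumerates the nonzero eigenvalues of T†T; their number is the rank r.
  let f := (Fintype.equivFin {i // l i ≠ 0}).symm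
  have hpos : ∀ i, 0 < l (f i) := fun i => (hnn _).lt_of_ne' (f i).2
  have hfinj : Function.Injective fun i => (f i).1 :=
    Subtype.val_injective.comp f.injective
  have hsq : ∀ i, √(l (f i)) * √(l (f i)) = l (f i) := fun i => Real.mul_self_sqrt (hnn _)
  have hs : ∀ i, √(l (f i)) ≠ 0 := fun i => (Real.sqrt_pos.2 (hpos i)).ne'
  refine ⟨_, fun i => e (f i), fun i => (√(l (f i)))⁻¹ • T (e (f i)), fun i => √(l (f i)),
    e.orthonormal.comp _ hfinj, ?_, fun i => Real.sqrt_pos.2 (hpos i), ?_, ?_, ?_⟩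
  · rw [orthonormal_iff_ite]
    intro i j
    rw [real_inner_smul_left, real_inner_smul_right, hin]
    by_cases hij : i = j
    · subst hij
      rw [if_pos rfl, if_pos rfl, ← mul_assoc, ← mul_inv, hsq, inv_mul_cancel₀ (hpos i).ne']
    · rw [if_neg hij, if_neg (fun h => hij (hfinj h)), mul_zero, mul_zero]
  · intro i
    rw [smul_inv_smul₀ (hs i)]
  · intro i
    rw [map_smul, hTe, smul_smul]
    congr 1
    rw [inv_mul_eq_iff_eq_mul₀ (hs i), hsq]
  · intro x hx
    -- Since ‖T e_i‖² = l i, eigenvectors with l i = 0 are killed by `T`; along the others `x` has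
    -- no component.
    rw [← e.sum_repr' x, map_sum]
    refine Finset.sum_eq_zero fun i _ => ?_
    rw [map_smul]
    by_cases hi : l i = 0
    · have : T (e i) = 0 := by
        rw [← inner_self_eq_zero (𝕜 := ℝ), hin, if_pos rfl, hi]
      rw [this, smul_zero]
    · have := hx (f.symm ⟨i, hi⟩)
      simp only [Equiv.apply_symm_apply] at this
      rw [this, zero_smul]

/-- The left basis of a singular value decomposition of `T` can be any orthonormal eigenbasis of
`T ∘ T†`, when the domain is large enough. -/
theorem LinearMap.exists_svd_of_eigenbasis {a b : ℕ} (hab : a ≤ b) (hV : finrank ℝ V = b)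
    (T : V →ₗ[ℝ] W) (e : OrthonormalBasis (Fin a) ℝ W)
    (he : ∀ j, ∃ μ : ℝ, T (T.adjoint (e j)) = μ • e j) :
    ∃ (c : OrthonormalBasis (Fin b) ℝ V) (σ : Fin a → ℝ), (∀ i, 0 ≤ σ i) ∧
      ∀ i j, inner ℝ (e i) (T (c j)) = if (i : ℕ) = j then σ i else 0 := by
  obtain ⟨c, σ, hσ, hc⟩ := T.adjoint.exists_orthonormalBasis_apply_eq_smul hab hV e (by
    intro i j hij
    obtain ⟨μ, hμ⟩ := he j
    rw [LinearMap.adjoint_inner_left, hμ, real_inner_smul_right, e.orthonormal.2 hij, mul_zero])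
  refine ⟨c, σ, hσ, fun i j => ?_⟩
  rw [← LinearMap.adjoint_inner_left, hc, real_inner_smul_left,
    orthonormal_iff_ite.1 c.orthonormal]
  simp [Fin.ext_iff]

/-- If `S†` vanishes on the range of `T` and `R†` vanishes on the range of `T†`, then `T` has a
singular value decomposition whose bases are eigenbases of `S ∘ S†` and `R ∘ R†`. -/
theorem LinearMap.exists_svd_of_comp_eq_zero {U : Type*} [NormedAddCommGroup U]
    [InnerProductSpace ℝ U] [FiniteDimensional ℝ U] {n m : ℕ} (hW : finrank ℝ W = n)
    (hV : finrank ℝ V = m) (T : V →ₗ[ℝ] W) (S : U →ₗ[ℝ] W) (R : U →ₗ[ℝ] V)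
    (hS : ∀ x, S.adjoint (T x) = 0) (hR : ∀ x, R.adjoint (T.adjoint x) = 0) :
    ∃ (e : OrthonormalBasis (Fin n) ℝ W) (c : OrthonormalBasis (Fin m) ℝ V),
      (∀ j, ∃ μ : ℝ, S (S.adjoint (e j)) = μ • e j) ∧
      (∀ j, ∃ μ : ℝ, R (R.adjoint (c j)) = μ • c j) ∧
      (∀ (i : Fin n) (j : Fin m), (i : ℕ) ≠ j → inner ℝ (e i) (T (c j)) = 0) ∧
      (∀ (i : Fin n) (j : Fin m), (i : ℕ) = j → 0 ≤ inner ℝ (e i) (T (c j))) := by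
  obtain ⟨r, v, u, σ, hv, hu, hσ, hTv, hTu, hker⟩ := T.exists_compact_svd
  -- As σ i > 0, `u i` lies in the range of `T`.
  have hSu : ∀ i, S.adjoint (u i) = 0 := fun i => by
    have := hS (v i)
    rw [hTv, map_smul] at this
    exact (smul_eq_zero_iff_right (hσ i).ne').1 this
  have hRv : ∀ i, R.adjoint (v i) = 0 := fun i => by
    have := hR (u i)
    rw [hTu, map_smul] at this
    exact (smul_eq_zero_iff_right (hσ i).ne').1 this
  obtain ⟨e, heu, he⟩ :=
    S.isPositive_self_comp_adjoint.isSymmetric.exists_orthonormalBasis_extension hW hu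
      (fun i => by simp [hSu])
  obtain ⟨c, hcv, hc⟩ :=
    R.isPositive_self_comp_adjoint.isSymmetric.exists_orthonormalBasis_extension hV hv
      (fun i => by simp [hRv])
  have hr : r ≤ n := by
    simpa [hW] using hu.linearIndependent.fintype_card_le_finrank
  have hr' : r ≤ m := by
    simpa [hV] using hv.linearIndependent.fintype_card_le_finrank
  have hTc : ∀ j : Fin m, T (c j) = if h : (j : ℕ) < r
      then σ ⟨j, h⟩ • e ⟨j, h.trans_le hr⟩ else 0 := by
    intro j
    split_ifs with h
    · rw [hcv ⟨j, h⟩ j rfl, hTv, heu ⟨j, h⟩ _ rfl]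
    -- Past index r, `c j` is orthogonal to every `v i`.
    · refine hker _ fun i => ?_
      rw [← hcv i (Fin.castLE hr' i) rfl]
      refine c.orthonormal.2 fun hij => h ?_
      rw [← hij]
      exact i.2
  refine ⟨e, c, he, hc, fun i j hij => ?_, fun i j hij => ?_⟩
  · rw [hTc]
    split_ifs with h
    · rw [real_inner_smul_right, e.orthonormal.2, mul_zero]
      exact fun h' => hij (congrArg Fin.val h')
    · exact inner_zero_right _
  · rw [hTc]
    split_ifs with h
    · have : (⟨j, h.trans_le hr⟩ : Fin n) = i := Fin.ext hij.symm
      rw [real_inner_smul_right, this]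
      exact mul_nonneg (hσ _).le real_inner_self_nonneg
    · exact (inner_zero_right _).ge

end LinearMap

/-! ### Translation to matrices -/

/-- Orthonormal bases in which the matrix of `A` is nonnegative diagonal give a singular value
decomposition. -/
theorem isSVD_of_orthonormalBasis {a b : ℕ} {A : Matrix (Fin a) (Fin b) ℝ}
    (e : OrthonormalBasis (Fin a) ℝ (EuclideanSpace ℝ (Fin a)))
    (c : OrthonormalBasis (Fin b) ℝ (EuclideanSpace ℝ (Fin b)))
    (h : IsNonnegRectDiagonal (Matrix.of fun i j => inner ℝ (e i) (A.toEuclideanLin (c j)))) :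
    IsSVD A (Matrix.of fun i j => e j i)
      (Matrix.of fun i j => inner ℝ (e i) (A.toEuclideanLin (c j)))
      (Matrix.of fun i j => c j i) := by
  have key : ∀ {d : ℕ} (f : OrthonormalBasis (Fin d) ℝ (EuclideanSpace ℝ (Fin d))),
      (Matrix.of fun i j => f j i) ∈ Matrix.orthogonalGroup (Fin d) ℝ := fun f =>
    (EuclideanSpace.basisFun _ ℝ).toMatrix_orthonormalBasis_mem_orthogonal f
  refine ⟨key e, key c, h, ?_⟩
  have hS : (Matrix.of fun i j => inner ℝ (e i) (A.toEuclideanLin (c j))) =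
      (Matrix.of fun i j => e j i).transpose * A * (Matrix.of fun i j => c j i) := by
    ext i j
    rw [Matrix.mul_assoc]
    simp only [Matrix.of_apply, EuclideanSpace.inner_eq_star_dotProduct, star_trivial]
    rw [dotProduct_comm]
    rfl
  have h1 := (Matrix.mem_orthogonalGroup_iff (Fin a) ℝ).1 (key e)
  have h2 := (Matrix.mem_orthogonalGroup_iff (Fin b) ℝ).1 (key c)
  rw [hS, ← Matrix.mul_assoc, ← Matrix.mul_assoc]
  change _ * Matrix.transpose _ = 1 at h1 h2
  rw [h1, Matrix.one_mul, Matrix.mul_assoc, h2, Matrix.mul_one]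

/-- Factorizations sharing the orthogonal factor in the middle have product zero iff the product of
their cores vanishes. -/
theorem orthogonal_mul_mul_eq_zero_iff {a b c : ℕ} {U : Matrix (Fin a) (Fin a) ℝ}
    {M : Matrix (Fin a) (Fin b) ℝ} {C : Matrix (Fin b) (Fin b) ℝ} {N : Matrix (Fin b) (Fin c) ℝ}
    {G : Matrix (Fin c) (Fin c) ℝ} (hU : U ∈ Matrix.orthogonalGroup (Fin a) ℝ)
    (hC : C ∈ Matrix.orthogonalGroup (Fin b) ℝ) (hG : G ∈ Matrix.orthogonalGroup (Fin c) ℝ) :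
    (U * M * C.transpose) * (C * N * G.transpose) = 0 ↔ M * N = 0 := by
  have hU' := (Matrix.mem_orthogonalGroup_iff' (Fin a) ℝ).1 hU
  have hC' := (Matrix.mem_orthogonalGroup_iff' (Fin b) ℝ).1 hC
  have hG' := (Matrix.mem_orthogonalGroup_iff' (Fin c) ℝ).1 hG
  change Matrix.transpose _ * _ = 1 at hU' hC' hG'
  have h : (U * M * C.transpose) * (C * N * G.transpose) = U * (M * N) * G.transpose := by
    calc _ = U * M * (C.transpose * C) * N * G.transpose := by simp only [Matrix.mul_assoc]
      _ = _ := by rw [hC', Matrix.mul_one]; simp only [Matrix.mul_assoc]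
  rw [h]
  constructor
  · intro h0
    calc M * N = (U.transpose * U) * (M * N) * (G.transpose * G) := by
          rw [hU', hG', Matrix.one_mul, Matrix.mul_one]
      _ = U.transpose * (U * (M * N) * G.transpose) * G := by simp only [Matrix.mul_assoc]
      _ = 0 := by rw [h0, Matrix.mul_zero, Matrix.zero_mul]
  · intro h0
    rw [h0, Matrix.mul_zero, Matrix.zero_mul]

/-- Matrices `E`, `P`, `Q` with `E * Q = 0` and `Eᵀ * P = 0` have singular value decompositions
with matching left and right factors. -/
theorem exists_isSVD_of_mul_eq_zero {n m k : ℕ} (hnk : n ≤ k) (hmk : m ≤ k)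
    {E : Matrix (Fin n) (Fin m) ℝ} {P : Matrix (Fin n) (Fin k) ℝ} {Q : Matrix (Fin m) (Fin k) ℝ}
    (hQ : E * Q = 0) (hP : E.transpose * P = 0) :
    ∃ (Ψ : Matrix (Fin n) (Fin n) ℝ) (S : Matrix (Fin n) (Fin m) ℝ)
      (Φ : Matrix (Fin m) (Fin m) ℝ) (ΓP ΓQ : Matrix (Fin k) (Fin k) ℝ)
      (SP : Matrix (Fin n) (Fin k) ℝ) (SQ : Matrix (Fin m) (Fin k) ℝ),
      IsSVD E Ψ S Φ ∧ IsSVD P Ψ SP ΓP ∧ IsSVD Q Φ SQ ΓQ := by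
  have hPE : P.transpose * E = 0 := by
    rw [← Matrix.transpose_eq_zero, Matrix.transpose_mul, Matrix.transpose_transpose, hP]
  have hQE : Q.transpose * E.transpose = 0 := by
    rw [← Matrix.transpose_mul, hQ, Matrix.transpose_zero]
  have hadj : ∀ {a b : ℕ} (A : Matrix (Fin a) (Fin b) ℝ),
      A.toEuclideanLin.adjoint = A.transpose.toEuclideanLin := fun A => by
    rw [← Matrix.toEuclideanLin_conjTranspose_eq_adjoint,
      Matrix.conjTranspose_eq_transpose_of_trivial]
  have hcomp : ∀ {a b c : ℕ} (A : Matrix (Fin a) (Fin b) ℝ) (B : Matrix (Fin b) (Fin c) ℝ),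
      A * B = 0 → ∀ x, A.toEuclideanLin (B.toEuclideanLin x) = 0 := fun A B h x => by
    ext1
    simp [Matrix.mulVec_mulVec, h]
  obtain ⟨e, c, he, hc, h0, h1⟩ := LinearMap.exists_svd_of_comp_eq_zero
    finrank_euclideanSpace_fin finrank_euclideanSpace_fin
    E.toEuclideanLin P.toEuclideanLin Q.toEuclideanLin
    (fun x => by rw [hadj]; exact hcomp _ _ hPE x)
    (fun x => by rw [hadj, hadj]; exact hcomp _ _ hQE x)
  have hdiag : ∀ {a : ℕ} (A : Matrix (Fin a) (Fin k) ℝ) (_ : a ≤ k)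
      (f : OrthonormalBasis (Fin a) ℝ (EuclideanSpace ℝ (Fin a)))
      (_ : ∀ j, ∃ μ : ℝ, A.toEuclideanLin (A.toEuclideanLin.adjoint (f j)) = μ • f j),
      ∃ S G, IsSVD A (Matrix.of fun i j => f j i) S G := by
    intro a A hak f hf
    obtain ⟨g, σ, hσ, hg⟩ := A.toEuclideanLin.exists_svd_of_eigenbasis hak
      finrank_euclideanSpace_fin f hf
    refine ⟨_, _, isSVD_of_orthonormalBasis f g ⟨fun i j hij => ?_, fun i j hij => ?_⟩⟩
    · rw [Matrix.of_apply, hg, if_neg hij]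
    · rw [Matrix.of_apply, hg, if_pos hij]
      exact hσ i
  obtain ⟨SP, ΓP, hSP⟩ := hdiag P hnk e he
  obtain ⟨SQ, ΓQ, hSQ⟩ := hdiag Q hmk c hc
  exact ⟨_, _, _, ΓP, ΓQ, SP, SQ, isSVD_of_orthonormalBasis e c ⟨h0, h1⟩, hSP, hSQ⟩

theorem isEquilibriumPoint_gradFlowField_iff {n m k : ℕ} (Y : Matrix (Fin n) (Fin m) ℝ)
    (P : Matrix (Fin n) (Fin k) ℝ) (Q : Matrix (Fin m) (Fin k) ℝ) :
    IsEquilibriumPoint (gradFlowField Y) (Matrix.fromRows P Q) ↔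
      (Y - P * Q.transpose) * Q = 0 ∧ (Y - P * Q.transpose).transpose * P = 0 := by
  simp only [IsEquilibriumPoint, gradFlowField, Matrix.toRows₁_fromRows, Matrix.toRows₂_fromRows]
  rw [← Matrix.fromRows_zero, Matrix.fromRows_ext_iff]

theorem mainTheorem4 (n m k : ℕ) (hnk : n ≤ k) (hmk : m ≤ k)
    (Y : Matrix (Fin n) (Fin m) ℝ) (P : Matrix (Fin n) (Fin k) ℝ) (Q : Matrix (Fin m) (Fin k) ℝ) :
    IsEquilibriumPoint (gradFlowField Y) (Matrix.fromRows P Q) ↔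
      ∃ (Ψ : Matrix (Fin n) (Fin n) ℝ) (S : Matrix (Fin n) (Fin m) ℝ)
        (Φ : Matrix (Fin m) (Fin m) ℝ)
        (ΓP ΓQ : Matrix (Fin k) (Fin k) ℝ)
        (SP : Matrix (Fin n) (Fin k) ℝ) (SQ : Matrix (Fin m) (Fin k) ℝ),
        IsSVD (Y - P * Q.transpose) Ψ S Φ ∧
        IsSVD P Ψ SP ΓP ∧
        IsSVD Q Φ SQ ΓQ ∧
        S * SQ = 0 ∧
        S.transpose * SP = 0 := by
  rw [isEquilibriumPoint_gradFlowField_iff]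
  -- Serves both directions: only the existence of matching decompositions remains for the forward
  -- one.
  have key : ∀ {E : Matrix (Fin n) (Fin m) ℝ} {Ψ S Φ ΓP ΓQ SP SQ},
      IsSVD E Ψ S Φ → IsSVD P Ψ SP ΓP → IsSVD Q Φ SQ ΓQ →
      ((E * Q = 0 ∧ E.transpose * P = 0) ↔ (S * SQ = 0 ∧ S.transpose * SP = 0)) := by
    intro E Ψ S Φ ΓP ΓQ SP SQ hE hP hQ
    have hT : E.transpose = Φ * S.transpose * Ψ.transpose := by
      rw [hE.eq_mul, Matrix.transpose_mul, Matrix.transpose_mul, Matrix.transpose_transpose,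
        Matrix.mul_assoc]
    rw [hT, hE.eq_mul, hP.eq_mul, hQ.eq_mul,
      orthogonal_mul_mul_eq_zero_iff hE.left_orthogonal hE.right_orthogonal hQ.right_orthogonal,
      orthogonal_mul_mul_eq_zero_iff hE.right_orthogonal hE.left_orthogonal hP.right_orthogonal]
  constructor
  · rintro ⟨hQ, hP⟩
    obtain ⟨Ψ, S, Φ, ΓP, ΓQ, SP, SQ, h1, h2, h3⟩ := exists_isSVD_of_mul_eq_zero hnk hmk hQ hP
    obtain ⟨h4, h5⟩ := (key h1 h2 h3).1 ⟨hQ, hP⟩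
    exact ⟨Ψ, S, Φ, ΓP, ΓQ, SP, SQ, h1, h2, h3, h4, h5⟩
  · rintro ⟨Ψ, S, Φ, ΓP, ΓQ, SP, SQ, h1, h2, h3, h45⟩
    exact (key h1 h2 h3).2 h45
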